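/- Let $D\subset\mathbb R^2$ and let $N$ agents have continuous trajectories $\mathbf s_j:[0,\infty)\to\mathbb R^2$, $j=1,\dots,N$. Fix $i$ and let $$D_i=\{\mathbf x\in D:\ \|\mathbf x-\mathbf s_i(0)\|\le\|\mathbf x-\mathbf s_j(0)\|\ \text{ for all } j\ne i\}$$ be the Voronoi cell of agent $i$. Assume that the interior $\Omega_i$ of $D_i$ is connected, that $D_i\subset\overline{\Omega_i}$, and that $\mathbf s_i(\tau)\in D_i$ for all $\tau\ge 0$. Let $P_j>0$, $\lambda_j>0$, $r>0$, and put $p_j(\mathbf x,\mathbf s)=P_je^{-\lambda_j\|\mathbf x-\mathbf s\|}$ if $\|\mathbf x-\mathbf s\|\le r$ and $p_j(\mathbf x,\mathbf s)=0$ otherwise. Let $m_0:\mathbb R^2\to\mathbb R$ be measurable, with $m_0\ge 0$ on $D$, bounded above on $D_i$, and with $\bar m_i=\sup_{D_i}m_0>0$. Define $$m(\mathbf x,t)=\max\Big(0,\;m_0(\mathbf x)-\sum_{j=1}^N\int_0^t p_j(\mathbf x,\mathbf s_j(\tau))\,d\tau\Big),\qquad h_i(\mathbf x,t)=\frac{m(\mathbf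 x,t)}{\bar m_i}.$$ Let $\alpha,\beta>0$. Suppose that, for every $t\ge 0$, $h_i(\cdot,t)\in L^2(\Omega_i)$ (which is automatic if $D$ is bounded) and $T_i(\cdot,t)\in H^1(\Omega_i)$ is a weak solution of $$\alpha\Delta T_i(\mathbf x,t)+h_i(\mathbf x,t)=\beta T_i(\mathbf x,t)\ \text{ in }\Omega_i,\qquad \frac{\partial T_i}{\partial\mathbf n}=0\ \text{ on }\partial\Omega_i,$$ that is, $\int_{\Omega_i} h_i v=\alpha\int_{\Omega_i}\nabla T_i\cdot\nabla v+\beta\int_{\Omega_i}T_i v$ for all $v\in H^1(\Omega_i)$. Then for every $t\ge 0$: 1. $h_i(\mathbf x,t)=0$ for almost every $\mathbf x\in\Omega_i$ if and only if, for every $\Delta t\ge 0$, the weak gradient satisfies $\nabla T_i(\mathbf x,t+\Delta t)=0$ for almost every $\mathbf x\in\Omega_i$. 2. If moreover $m_0$ is lower semicontinuous on $D_i$ (for instance continuous) and $T_i(\cdot,\tau)$ is continuous on $D_i$ for every $\tau\ge0$, then $h_i(\mathbf x,t)=0$ for every $\mathbf x\in D_i$ if and only if, for every $\Delta t\ge 0$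 and every $\mathbf x\in D_i$, $\nabla T_i(\mathbf x,t+\Delta t)=0$ (the function $T_i(\cdot,t+\Delta t)$ is differentiable at $\mathbf x$ relative to $D_i$, with gradient $0$). -/

import Mathlib

noncomputable section

namespace HeatCoverage

/-- The plane `ℝ²` with its Euclidean norm. -/
abbrev Plane : Type := EuclideanSpace ℝ (Fin 2)

/-- The Voronoi cell, inside the workspace `D`, of the site `q i`. -/
def voronoiCell {N : ℕ} (D : Set Plane) (q : Fin N → Plane) (i : Fin N) : Set Plane :=
  {x | x ∈ D ∧ ∀ j : Fin N, j ≠ i → dist x (q i) ≤ dist x (q j)}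

/-- Coverage per unit time, at the point `x`, of an agent located at `y` with maximal capacity `P`,
attenuation coefficient `lam` and effective radius `r`. -/
def coverageRate (P lam r : ℝ) (x y : Plane) : ℝ :=
  if dist x y ≤ r then P * Real.exp (-lam * dist x y) else 0

/-- Total coverage of the point `x` during `[0, t]` by an agent with trajectory `s`. -/
def coverage (P lam r : ℝ) (s : ℝ → Plane) (x : Plane) (t : ℝ) : ℝ :=
  ∫ τ in (0 : ℝ)..t, coverageRate P lam r x (s τ)

/-- Workload left at the point `x` at time `t`. -/
def workload {N : ℕ} (P lam : Fin N → ℝ) (r : ℝ) (s : Fin N → ℝ → Plane) (m₀ : Plane → ℝ)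
    (x : Plane) (t : ℝ) : ℝ :=
  max 0 (m₀ x - ∑ j, coverage (P j) (lam j) r (s j) x t)

/-- The maximal initial workload on the cell `C`. -/
def maxWorkload (m₀ : Plane → ℝ) (C : Set Plane) : ℝ := sSup (m₀ '' C)

/-- The internal heat source on the cell `C`: the workload divided by the maximal initial
workload on `C`. -/
def heatSource {N : ℕ} (P lam : Fin N → ℝ) (r : ℝ) (s : Fin N → ℝ → Plane) (m₀ : Plane → ℝ)
    (C : Set Plane) (x : Plane) (t : ℝ) : ℝ :=
  workload P lam r s m₀ x t / maxWorkload m₀ C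

/-- `G` is the weak (distributional) gradient of `u` on the open set `Ω`. It is used only for
square-integrable `u` and `G`, so that all the integrals converge. -/
def HasWeakGradient (Ω : Set Plane) (u : Plane → ℝ) (G : Plane → Plane) : Prop :=
  ∀ φ : Plane → ℝ, ContDiff ℝ (⊤ : ℕ∞) φ → HasCompactSupport φ → tsupport φ ⊆ Ω →
    ∫ x in Ω, u x • gradient φ x = -∫ x in Ω, φ x • G x

/-- `u` belongs to the Sobolev space `H¹(Ω)` and `G` is its weak gradient. -/
def IsH1 (Ω : Set Plane) (u : Plane → ℝ) (G : Plane → Plane) : Prop :=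
  MeasureTheory.MemLp u 2 (MeasureTheory.volume.restrict Ω) ∧
  MeasureTheory.MemLp G 2 (MeasureTheory.volume.restrict Ω) ∧
  HasWeakGradient Ω u G

/-- `u`, with weak gradient `G`, is a weak solution of `α Δu + f = β u` in the open set `Ω` with
the boundary condition `∂u/∂n = 0`, for a source `f` in `L²(Ω)`. The test functions range over all
of `H¹(Ω)`, which encodes the homogeneous Neumann condition. -/
def IsNeumannSolution (α β : ℝ) (Ω : Set Plane) (f : Plane → ℝ)
    (u : Plane → ℝ) (G : Plane → Plane) : Prop :=
  MeasureTheory.MemLp f 2 (MeasureTheory.volume.restrict Ω) ∧ IsH1 Ω u G ∧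
  ∀ (v : Plane → ℝ) (H : Plane → Plane), IsH1 Ω v H →
    ∫ x in Ω, f x * v x = α * (∫ x in Ω, inner ℝ (G x) (H x)) + β * ∫ x in Ω, u x * v x

end HeatCoverage

end

namespace HeatCoverage

open MeasureTheory Filter Topology Set

/-! If the source vanishes at time `t`, it vanishes at all later times, because coverage only
accumulates. Testing the equation with `T` itself gives `α ∫ |∇T|² + β ∫ T² = 0`, so `T` and its
gradient vanish (`IsNeumannSolution.ae_eq_zero`).

Conversely, a vanishing weak gradient on the connected set `Ω` forces `T` to be constant
(`HasWeakGradient.exists_ae_eq_const`). The equation then reads `h = β T`, so the workload is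
constant in space at every time from `t` on (`IsNeumannSolution.exists_source_ae_eq_const`). If this
constant were positive at time `t`, the truncation at 0 would be inactive there, and differentiating
in time would make the total coverage rate at time `t` constant on `Ω`. That is impossible near
agent `i` (`not_ae_sum_coverageRate_eq_const`): off the circles of radius `r`, the rate is locally a
finite sum of terms `P e^{-λ dist}`, which is analytic off the sites. If constant on an open set, it
would be constant off the sites, and decay at infinity would make it 0, although it is positive
within distance `r` of agent `i`.

The pointwise statement follows by semicontinuity of the workload and continuity of `T`. -/

/-! ### Weak gradients and constant functions. -/

theorem gradient_comp_const_sub {φ : Plane → ℝ} (hφ : Differentiable ℝ φ) (y x : Plane) :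
    gradient (fun z => φ (y - z)) x = -gradient φ (y - x) := by
  have h : fderiv ℝ (fun z => φ (y - z)) x = -fderiv ℝ φ (y - x) := by
    have h1 : HasFDerivAt (fun z => y - z) (-ContinuousLinearMap.id ℝ Plane) x :=
      (hasFDerivAt_id x).const_sub y
    refine ((hφ (y - x)).hasFDerivAt.comp x h1).fderiv.trans ?_
    ext v
    simp
  rw [gradient, gradient, h, map_neg]

/-- Mollifications of a function with vanishing weak gradient have vanishing derivative at the
points where the support of the mollifier fits into the domain. -/
theorem HasWeakGradient.hasFDerivAt_convolution_zero {Ω : Set Plane} (hΩ : MeasurableSet Ω)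
    {u : Plane → ℝ} {G : Plane → Plane} (h : HasWeakGradient Ω u G)
    (hG : ∀ᵐ x ∂(volume.restrict Ω), G x = 0)
    (hu : LocallyIntegrable (Ω.indicator u) volume)
    (φ : ContDiffBump (0 : Plane)) {y : Plane} (hy : Metric.closedBall y φ.rOut ⊆ Ω) :
    HasFDerivAt (convolution (φ.normed volume) (Ω.indicator u)
      (ContinuousLinearMap.lsmul ℝ ℝ) volume) (0 : Plane →L[ℝ] ℝ) y := by
  set f := φ.normed (volume : Measure Plane) with hf
  have hfs : ContDiff ℝ (⊤ : ℕ∞) f := φ.contDiff_normed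
  have hfc : HasCompactSupport f := φ.hasCompactSupport_normed
  have key := hfc.hasFDerivAt_convolution_left (ContinuousLinearMap.lsmul ℝ ℝ)
    (hfs.of_le (by exact_mod_cast le_top)) hu y
  -- The reflected and translated mollifier is an admissible test function, since its support is the
  -- closed ball `hy`. The derivative of the convolution at `y` is, up to duality, the left side of
  -- the weak gradient identity for it.
  have hψ := h (fun z => f (y - z)) (hfs.comp (contDiff_const.sub contDiff_id))
    (hfc.comp_homeomorph (Homeomorph.subLeft y)) (by
      intro z hz
      apply hy
      have h1 : z ∈ (Homeomorph.subLeft y) ⁻¹' tsupport f := by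
        rw [← tsupport_comp_eq_preimage]; exact hz
      rw [φ.tsupport_normed_eq] at h1
      simpa [dist_eq_norm, norm_sub_rev] using h1)
  have hz : ∫ x in Ω, f (y - x) • G x = 0 := by
    rw [integral_eq_zero_of_ae]
    filter_upwards [hG] with x hx
    simp [hx]
  rw [hz, neg_zero, ← integral_indicator hΩ] at hψ
  convert! key using 1
  rw [convolution_eq_swap]
  have : ∀ t, (ContinuousLinearMap.precompL Plane (ContinuousLinearMap.lsmul ℝ ℝ)
      (fderiv ℝ f (y - t))) (Ω.indicator u t) =
      (InnerProductSpace.toDual ℝ Plane)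
        (-(Ω.indicator (fun x => u x • gradient (fun z => f (y - z)) x) t)) := by
    intro t
    by_cases ht : t ∈ Ω
    · rw [indicator_of_mem ht, indicator_of_mem ht,
        gradient_comp_const_sub (hfs.differentiable (by simp)), smul_neg, neg_neg, map_smul, toDual_gradient]
      ext v
      simp [mul_comm]
    · rw [indicator_of_notMem ht, indicator_of_notMem ht]
      simp
  simp_rw [this]
  have h2 := ((InnerProductSpace.toDual ℝ Plane).toContinuousLinearEquiv).integral_comp_comm
    (μ := volume) (fun t => -(Ω.indicator (fun x => u x • gradient (fun z => f (y - z)) x) t))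
  rw [integral_neg, hψ] at h2
  simpa using h2.symm

/-- A locally constant function on a preconnected open set is constant. -/
theorem exists_eq_const_of_locally_eq {Ω : Set Plane} (hΩ : IsOpen Ω) (hc : IsPreconnected Ω)
    {g : Plane → ℝ} (hg : ∀ x ∈ Ω, g =ᶠ[𝓝 x] fun _ => g x) : ∃ a, ∀ x ∈ Ω, g x = a := by
  have hd : ∀ x ∈ Ω, HasFDerivAt g (0 : Plane →L[ℝ] ℝ) x := fun x hx =>
    (hasFDerivAt_const (g x) x).congr_of_eventuallyEq (hg x hx)
  exact hΩ.exists_is_const_of_fderiv_eq_zero hc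
    (fun x hx => (hd x hx).differentiableAt.differentiableWithinAt)
    (fun x hx => (hd x hx).fderiv)

/-- A function with vanishing weak gradient on a connected open set is almost everywhere
constant. -/
theorem HasWeakGradient.exists_ae_eq_const {Ω : Set Plane} (hΩ : IsOpen Ω)
    (hc : IsPreconnected Ω) {u : Plane → ℝ} {G : Plane → Plane} (h : HasWeakGradient Ω u G)
    (hu : MemLp u 2 (volume.restrict Ω)) (hG : ∀ᵐ x ∂(volume.restrict Ω), G x = 0) :
    ∃ a, ∀ᵐ x ∂(volume.restrict Ω), u x = a := by
  have hu' : LocallyIntegrable (Ω.indicator u) volume :=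
    ((memLp_indicator_iff_restrict hΩ.measurableSet).2 hu).locallyIntegrable (by norm_num)
  -- The radii shrink with fixed ratio 2, as the almost everywhere convergence of mollifications
  -- requires (`K = 2`).
  let φ : ℕ → ContDiffBump (0 : Plane) := fun n =>
    ⟨1 / ((n : ℝ) + 1), 2 * (1 / ((n : ℝ) + 1)), by positivity, by
      have : 0 < 1 / ((n : ℝ) + 1) := by positivity
      linarith⟩
  have hφ : Tendsto (fun n => (φ n).rOut) atTop (𝓝 0) := by
    simpa only [mul_zero] using (tendsto_one_div_add_atTop_nhds_zero_nat (𝕜 := ℝ)).const_mul 2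
  have hae := ContDiffBump.ae_convolution_tendsto_right_of_locallyIntegrable
    (φ := φ) (K := 2) hφ (Eventually.of_forall fun n => le_rfl) hu'
  set U : ℕ → Plane → ℝ := fun n => convolution ((φ n).normed volume) (Ω.indicator u)
      (ContinuousLinearMap.lsmul ℝ ℝ) volume with hU
  have hloc : ∀ x ∈ Ω, ∃ ε > 0, Metric.ball x ε ⊆ Ω ∧ ∀ᶠ n in atTop,
      ∀ y ∈ Metric.ball x ε, U n y = U n x := by
    intro x hx
    obtain ⟨ε, hε, hb⟩ := Metric.isOpen_iff.1 hΩ x hx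
    refine ⟨ε / 2, half_pos hε, (Metric.ball_subset_ball (half_le_self hε.le)).trans hb, ?_⟩
    filter_upwards [hφ.eventually_lt_const (half_pos hε)] with n hn y hy
    have hd : ∀ z ∈ Metric.ball x (ε / 2), HasFDerivAt (U n) (0 : Plane →L[ℝ] ℝ) z := by
      intro z hz
      refine h.hasFDerivAt_convolution_zero hΩ.measurableSet hG hu' (φ n) (fun w hw => hb ?_)
      rw [Metric.mem_ball] at hz ⊢
      rw [Metric.mem_closedBall] at hw
      linarith [dist_triangle w z x]
    exact Metric.isOpen_ball.is_const_of_fderiv_eq_zero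
      (convex_ball x (ε / 2)).isPreconnected
      (fun z hz => (hd z hz).differentiableAt.differentiableWithinAt)
      (fun z hz => (hd z hz).fderiv) hy (Metric.mem_ball_self (half_pos hε))
  -- Convergence at one point of the ball carries over to its center, because `U n` is eventually
  -- constant on the ball.
  have hconv : ∀ x ∈ Ω, ∃ l, Tendsto (fun n => U n x) atTop (𝓝 l) := by
    intro x hx
    obtain ⟨ε, hε, -, hev⟩ := hloc x hx
    obtain ⟨y, hy, hyt⟩ := (Measure.dense_of_ae hae).exists_mem_open Metric.isOpen_ball
      ⟨x, Metric.mem_ball_self hε⟩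
    exact ⟨_, hy.congr' (hev.mono fun n hn => hn y hyt)⟩
  choose! g hg using hconv
  obtain ⟨a, ha⟩ := exists_eq_const_of_locally_eq hΩ hc (g := g) (by
    intro x hx
    obtain ⟨ε, hε, hb, hev⟩ := hloc x hx
    filter_upwards [Metric.ball_mem_nhds x hε] with y hy
    exact tendsto_nhds_unique ((hg y (hb hy)).congr' (hev.mono fun n hn => hn y hy)) (hg x hx))
  refine ⟨a, (ae_restrict_iff' hΩ.measurableSet).2 ?_⟩
  filter_upwards [hae] with x hx hxΩ
  rw [← ha x hxΩ]
  rw [indicator_of_mem hxΩ] at hx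
  exact tendsto_nhds_unique hx (hg x hxΩ)

theorem integral_smul_gradient_eq_neg {f φ : Plane → ℝ} (hf : ContDiff ℝ 1 f)
    (hφ : ContDiff ℝ 1 φ) (hc : HasCompactSupport φ) :
    ∫ x, f x • gradient φ x = -∫ x, φ x • gradient f x := by
  have hcont : ∀ {k : Plane → ℝ}, ContDiff ℝ 1 k → Continuous (gradient k) := fun hk =>
    (InnerProductSpace.toDual ℝ Plane).symm.continuous.comp (hk.continuous_fderiv one_ne_zero)
  have hcg : HasCompactSupport (gradient φ) :=
    (hc.fderiv ℝ).comp_left (g := (InnerProductSpace.toDual ℝ Plane).symm) (map_zero _)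
  have i1 : Integrable (fun x => f x • gradient φ x) :=
    (hf.continuous.smul (hcont hφ)).integrable_of_hasCompactSupport hcg.smul_left
  have i2 : Integrable (fun x => φ x • gradient f x) :=
    (hφ.continuous.smul (hcont hf)).integrable_of_hasCompactSupport hc.smul_right
  -- Pairing with a fixed vector `v` reduces the claim to scalar integration by parts.
  refine ext_inner_left ℝ fun v => ?_
  rw [inner_neg_right, ← integral_inner i1, ← integral_inner i2]
  have e1 : ∀ x, inner ℝ v (f x • gradient φ x) = f x * fderiv ℝ φ x v := fun x => by
    simp [inner_smul_right, inner_gradient_right]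
  have e2 : ∀ x, inner ℝ v (φ x • gradient f x) = fderiv ℝ f x v * φ x := fun x => by
    simp [inner_smul_right, inner_gradient_right, mul_comm]
  have j1 := i1.const_inner (𝕜 := ℝ) v
  have j2 := i2.const_inner (𝕜 := ℝ) v
  simp only [e1] at j1 ⊢
  simp only [e2] at j2 ⊢
  exact integral_mul_fderiv_eq_neg_fderiv_mul_of_integrable j2 j1
    ((hf.continuous.mul hφ.continuous).integrable_of_hasCompactSupport hc.mul_left)
    (fun x _ => hf.differentiable one_ne_zero x) (fun x _ => hφ.differentiable one_ne_zero x)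

theorem gradient_eq_zero_of_notMem_tsupport {φ : Plane → ℝ} {x : Plane} (hx : x ∉ tsupport φ) :
    gradient φ x = 0 := by
  rw [gradient, image_eq_zero_of_notMem_tsupport (fun h => hx (tsupport_fderiv_subset ℝ h)),
    map_zero]

/-- Test functions belong to `H¹`. -/
theorem isH1_of_contDiff {Ω : Set Plane} {φ : Plane → ℝ} (hφ : ContDiff ℝ (⊤ : ℕ∞) φ)
    (hc : HasCompactSupport φ) : IsH1 Ω φ (gradient φ) := by
  have hφ1 : ContDiff ℝ 1 φ := hφ.of_le (by exact_mod_cast le_top)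
  have hcg : HasCompactSupport (gradient φ) :=
    (hc.fderiv ℝ).comp_left (g := (InnerProductSpace.toDual ℝ Plane).symm) (map_zero _)
  refine ⟨hφ.continuous.memLp_of_hasCompactSupport hc,
    ((InnerProductSpace.toDual ℝ Plane).symm.continuous.comp
      (hφ1.continuous_fderiv one_ne_zero)).memLp_of_hasCompactSupport hcg, ?_⟩
  intro ψ hψ hψc hψs
  rw [setIntegral_eq_integral_of_forall_compl_eq_zero,
    setIntegral_eq_integral_of_forall_compl_eq_zero]
  · exact integral_smul_gradient_eq_neg hφ1 (hψ.of_le (by exact_mod_cast le_top)) hψc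
  · intro x hx
    rw [image_eq_zero_of_notMem_tsupport (fun h => hx (hψs h)), zero_smul]
  · intro x hx
    rw [gradient_eq_zero_of_notMem_tsupport (fun h => hx (hψs h)), smul_zero]

/-- The weak gradient of a constant function vanishes. -/
theorem IsH1.gradient_ae_eq_zero_of_const {Ω : Set Plane} (hΩ : IsOpen Ω) {u : Plane → ℝ}
    {G : Plane → Plane} (h : IsH1 Ω u G) {a : ℝ} (ha : ∀ x ∈ Ω, u x = a) :
    ∀ᵐ x ∂(volume.restrict Ω), G x = 0 := by
  rw [ae_restrict_iff' hΩ.measurableSet]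
  refine hΩ.ae_eq_zero_of_integral_contDiff_smul_eq_zero
    (locallyIntegrableOn_of_locallyIntegrable_restrict (h.2.1.locallyIntegrable (by norm_num))) ?_
  intro φ hφ hc hs
  have h1 := h.2.2 φ hφ hc hs
  -- With `u = a` on `Ω`, the left side is the integral of `a • gradient φ`, which is 0 by parts.
  rw [setIntegral_congr_fun (g := fun x => a • gradient φ x) hΩ.measurableSet
    (fun x hx => by simp only [ha x hx])] at h1
  rw [setIntegral_eq_integral_of_forall_compl_eq_zero,
    setIntegral_eq_integral_of_forall_compl_eq_zero,
    integral_smul_gradient_eq_neg contDiff_const (hφ.of_le (by exact_mod_cast le_top)) hc] at h1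
  · simpa [gradient_fun_const] using h1.symm
  · intro x hx
    rw [image_eq_zero_of_notMem_tsupport (fun h => hx (hs h)), zero_smul]
  · intro x hx
    rw [gradient_eq_zero_of_notMem_tsupport (fun h => hx (hs h)), smul_zero]

/-! ### The Neumann problem with zero source or zero gradient. -/

/-- Without a source, the Neumann problem has only the zero solution. -/
theorem IsNeumannSolution.ae_eq_zero {α β : ℝ} (hα : 0 < α) (hβ : 0 < β) {Ω : Set Plane}
    {f u : Plane → ℝ} {G : Plane → Plane} (h : IsNeumannSolution α β Ω f u G)
    (hf : ∀ᵐ x ∂(volume.restrict Ω), f x = 0) :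
    (∀ᵐ x ∂(volume.restrict Ω), u x = 0) ∧ ∀ᵐ x ∂(volume.restrict Ω), G x = 0 := by
  -- The solution itself is the test function.
  have h1 := h.2.2 u G h.2.1
  have h0 : ∫ x in Ω, f x * u x = 0 := by
    rw [integral_eq_zero_of_ae]
    filter_upwards [hf] with x hx
    simp [hx]
  have iu : Integrable (fun x => u x * u x) (volume.restrict Ω) :=
    h.2.1.1.integrable_mul h.2.1.1
  have iG : Integrable (fun x => inner ℝ (G x) (G x)) (volume.restrict Ω) := by
    simpa only [real_inner_self_eq_norm_sq] using h.2.1.2.1.integrable_norm_pow (by norm_num)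
  have pu : 0 ≤ ∫ x in Ω, u x * u x := integral_nonneg fun x => mul_self_nonneg _
  have pG : 0 ≤ ∫ x in Ω, inner ℝ (G x) (G x) :=
    integral_nonneg fun x => real_inner_self_nonneg
  rw [h0] at h1
  have zu : ∫ x in Ω, u x * u x = 0 := by nlinarith [mul_nonneg hα.le pG, mul_nonneg hβ.le pu]
  have zG : ∫ x in Ω, inner ℝ (G x) (G x) = 0 := by
    nlinarith [mul_nonneg hα.le pG, mul_nonneg hβ.le pu]
  rw [integral_eq_zero_iff_of_nonneg (fun x => mul_self_nonneg _) iu] at zu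
  rw [integral_eq_zero_iff_of_nonneg (fun x => real_inner_self_nonneg) iG] at zG
  exact ⟨zu.mono fun x hx => mul_self_eq_zero.1 hx, zG.mono fun x hx => inner_self_eq_zero.1 hx⟩

/-- If the solution of the Neumann problem has vanishing gradient, the source is constant. -/
theorem IsNeumannSolution.exists_source_ae_eq_const {α β : ℝ} {Ω : Set Plane} (hΩ : IsOpen Ω)
    (hc : IsPreconnected Ω) {f u : Plane → ℝ} {G : Plane → Plane}
    (h : IsNeumannSolution α β Ω f u G) (hG : ∀ᵐ x ∂(volume.restrict Ω), G x = 0) :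
    ∃ a, ∀ᵐ x ∂(volume.restrict Ω), f x = a := by
  obtain ⟨a, ha⟩ := h.2.1.2.2.exists_ae_eq_const hΩ hc h.2.1.1 hG
  -- The gradient term drops out for every smooth test function, leaving `f = β u` almost
  -- everywhere.
  have key : ∀ᵐ x ∂volume, x ∈ Ω → f x - β * u x = 0 := by
    refine hΩ.ae_eq_zero_of_integral_contDiff_smul_eq_zero
      (locallyIntegrableOn_of_locallyIntegrable_restrict
        ((h.1.sub (h.2.1.1.const_mul β)).locallyIntegrable (by norm_num))) ?_
    intro φ hφ hφc hs
    have hφ1 := isH1_of_contDiff (Ω := Ω) hφ hφc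
    have h1 := h.2.2 φ _ hφ1
    have h0 : ∫ x in Ω, inner ℝ (G x) (gradient φ x) = 0 := by
      rw [integral_eq_zero_of_ae]
      filter_upwards [hG] with x hx
      simp [hx]
    have if' : Integrable (fun x => f x * φ x) (volume.restrict Ω) := h.1.integrable_mul hφ1.1
    have iu : Integrable (fun x => u x * φ x) (volume.restrict Ω) :=
      h.2.1.1.integrable_mul hφ1.1
    rw [← setIntegral_eq_integral_of_forall_compl_eq_zero (s := Ω)]
    · rw [h0, mul_zero, zero_add, ← integral_const_mul, ← sub_eq_zero,
        ← integral_sub if' (iu.const_mul β)] at h1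
      rw [← h1]
      congr 1 with x
      simp only [smul_eq_mul]
      ring
    · intro x hx
      rw [image_eq_zero_of_notMem_tsupport (fun h => hx (hs h)), zero_smul]
  rw [← ae_restrict_iff' hΩ.measurableSet] at key
  refine ⟨β * a, ?_⟩
  filter_upwards [ha, key] with x hx hk
  rw [hx] at hk
  linarith

/-! ### Coverage by a single agent. -/

section Coverage

variable {P lam r : ℝ} {s : ℝ → Plane} {x : Plane} {t : ℝ}

theorem coverageRate_nonneg (hP : 0 ≤ P) (x y : Plane) : 0 ≤ coverageRate P lam r x y := by
  unfold coverageRate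
  split_ifs <;> positivity

theorem measurable_coverageRate (hs : Continuous s) (x : Plane) :
    Measurable fun τ => coverageRate P lam r x (s τ) := by
  have hd : Continuous fun τ => dist x (s τ) := continuous_const.dist hs
  refine Measurable.ite (hd.measurable measurableSet_Iic) ?_ measurable_const
  exact (continuous_const.mul (Real.continuous_exp.comp (continuous_const.mul hd))).measurable

theorem mul_exp_neg_mul_dist_le (hP : 0 ≤ P) (hlam : 0 ≤ lam) (x y : Plane) :
    P * Real.exp (-lam * dist x y) ≤ P := by
  have : Real.exp (-lam * dist x y) ≤ 1 := by
    rw [Real.exp_le_one_iff]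
    nlinarith [mul_nonneg hlam (dist_nonneg (x := x) (y := y))]
  nlinarith

theorem coverageRate_le (hP : 0 ≤ P) (hlam : 0 ≤ lam) (x y : Plane) :
    coverageRate P lam r x y ≤ P := by
  unfold coverageRate
  split_ifs
  · exact mul_exp_neg_mul_dist_le hP hlam x y
  · exact hP

theorem intervalIntegrable_coverageRate (hP : 0 ≤ P) (hlam : 0 ≤ lam) (hs : Continuous s)
    (x : Plane) (a b : ℝ) :
    IntervalIntegrable (fun τ => coverageRate P lam r x (s τ)) volume a b := by
  refine (intervalIntegrable_const (c := P)).mono_fun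
    (measurable_coverageRate hs x).aestronglyMeasurable (Eventually.of_forall fun τ => ?_)
  simp only [Real.norm_of_nonneg (coverageRate_nonneg hP _ _), Real.norm_of_nonneg hP]
  exact coverageRate_le hP hlam _ _

theorem coverage_mono (hP : 0 ≤ P) (hlam : 0 ≤ lam) (hs : Continuous s) (x : Plane) :
    Monotone (coverage P lam r s x) := by
  intro a b hab
  have h := intervalIntegral.integral_add_adjacent_intervals
    (intervalIntegrable_coverageRate (r := r) hP hlam hs x 0 a)
    (intervalIntegrable_coverageRate (r := r) hP hlam hs x a b)
  have h' : 0 ≤ ∫ τ in a..b, coverageRate P lam r x (s τ) :=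
    intervalIntegral.integral_nonneg hab fun τ _ => coverageRate_nonneg hP _ _
  unfold coverage
  linarith

/-- Off the circle of radius `r` around `s t`, the rate is continuous in time at `t`, so the
fundamental theorem of calculus applies. On the circle the cut-off may jump. -/
theorem hasDerivAt_coverage (hP : 0 ≤ P) (hlam : 0 ≤ lam) (hs : Continuous s)
    (hx : dist x (s t) ≠ r) :
    HasDerivAt (coverage P lam r s x) (coverageRate P lam r x (s t)) t := by
  have hd : Continuous fun τ => dist x (s τ) := continuous_const.dist hs
  refine intervalIntegral.integral_hasDerivAt_right
    (intervalIntegrable_coverageRate hP hlam hs x 0 t)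
    (measurable_coverageRate hs x).stronglyMeasurable.stronglyMeasurableAtFilter ?_
  rcases hx.lt_or_gt with h | h
  · refine ContinuousAt.congr (f := fun τ => P * Real.exp (-lam * dist x (s τ))) ?_ ?_
    · exact (continuous_const.mul (Real.continuous_exp.comp (continuous_const.mul hd))).continuousAt
    · filter_upwards [hd.continuousAt.eventually_lt_const h] with τ hτ
      rw [coverageRate, if_pos hτ.le]
  · refine ContinuousAt.congr (f := fun _ => 0) continuousAt_const ?_
    filter_upwards [hd.continuousAt.eventually_const_lt h] with τ hτ
    rw [coverageRate, if_neg hτ.not_ge]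

/-- The coverage is an upper semicontinuous function of the point. -/
theorem upperSemicontinuous_coverage (hP : 0 ≤ P) (hlam : 0 ≤ lam) (hs : Continuous s)
    (ht : 0 ≤ t) : UpperSemicontinuous fun x => coverage P lam r s x t := by
  intro x c hc
  -- `F` drops the cut-off at the times when `x` is within reach. It dominates the rate, equals it
  -- at `y = x`, and is continuous in `y` at `x`, since out of reach of `x` the rate vanishes for
  -- `y` near `x`. Dominated convergence with bound `P` then makes its integral continuous at `x`.
  let F : Plane → ℝ → ℝ := fun y τ =>
    if dist x (s τ) ≤ r then P * Real.exp (-lam * dist y (s τ)) else coverageRate P lam r y (s τ)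
  have hF : ∀ y τ, coverageRate P lam r y (s τ) ≤ F y τ := by
    intro y τ
    by_cases h : dist x (s τ) ≤ r
    · simp only [F, if_pos h]
      unfold coverageRate
      split_ifs
      · exact le_rfl
      · positivity
    · simp only [F, if_neg h, le_refl]
  have hFP : ∀ y τ, F y τ ≤ P := by
    intro y τ
    by_cases h : dist x (s τ) ≤ r
    · simp only [F, if_pos h]
      exact mul_exp_neg_mul_dist_le hP hlam _ _
    · simp only [F, if_neg h]
      exact coverageRate_le hP hlam _ _
  have hFn : ∀ y τ, ‖F y τ‖ ≤ P := fun y τ => by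
    rw [Real.norm_of_nonneg ((coverageRate_nonneg hP _ _).trans (hF y τ))]
    exact hFP y τ
  have hFm : ∀ y, Measurable (F y) := by
    intro y
    have hd : ∀ z : Plane, Continuous fun τ => dist z (s τ) := fun z => continuous_const.dist hs
    exact Measurable.ite ((hd x).measurable measurableSet_Iic)
      (continuous_const.mul (Real.continuous_exp.comp (continuous_const.mul (hd y)))).measurable
      (measurable_coverageRate hs y)
  have hcont : ContinuousAt (fun y => ∫ τ in (0 : ℝ)..t, F y τ) x := by
    refine intervalIntegral.continuousAt_of_dominated_interval (bound := fun _ => P)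
      (Eventually.of_forall fun y => (hFm y).aestronglyMeasurable)
      (Eventually.of_forall fun y => Eventually.of_forall fun τ _ => hFn y τ)
      intervalIntegrable_const (Eventually.of_forall fun τ _ => ?_)
    have hd : Continuous fun y : Plane => dist y (s τ) := continuous_id.dist continuous_const
    by_cases h : dist x (s τ) ≤ r
    · simp only [F, if_pos h]
      exact (continuous_const.mul (Real.continuous_exp.comp
        (continuous_const.mul hd))).continuousAt
    · simp only [F, if_neg h]
      refine ContinuousAt.congr (f := fun _ => 0) continuousAt_const ?_
      filter_upwards [hd.continuousAt.eventually_const_lt (not_le.1 h)] with y hy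
      rw [coverageRate, if_neg hy.not_ge]
  have hFx : ∫ τ in (0 : ℝ)..t, F x τ = coverage P lam r s x t := by
    refine intervalIntegral.integral_congr fun τ _ => ?_
    by_cases h : dist x (s τ) ≤ r
    · simp only [F, if_pos h, coverageRate]
    · simp only [F, if_neg h]
  filter_upwards [hcont.eventually_lt_const (hFx.trans_lt hc)] with y hy
  refine lt_of_le_of_lt (intervalIntegral.integral_mono_on ht
    (intervalIntegrable_coverageRate hP hlam hs y 0 t) ?_ fun τ _ => hF y τ) hy
  exact (intervalIntegrable_const (c := P)).mono_fun (hFm y).aestronglyMeasurable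
    (Eventually.of_forall fun τ => by rw [Real.norm_of_nonneg hP]; exact hFn y τ)

theorem coverage_congr {s' : ℝ → Plane} (h : ∀ τ, 0 ≤ τ → s τ = s' τ) (ht : 0 ≤ t) :
    coverage P lam r s x t = coverage P lam r s' x t := by
  refine intervalIntegral.integral_congr fun τ hτ => ?_
  rw [uIcc_of_le ht] at hτ
  simp only [h τ hτ.1]

end Coverage

/-! ### Nonconstancy of the total coverage rate. -/

variable {N : ℕ} {P lam : Fin N → ℝ} {r : ℝ}

/-- The total coverage rate is not constant on an open set with an agent in its closure. -/
theorem not_ae_sum_coverageRate_eq_const (hP : ∀ j, 0 < P j) (hlam : ∀ j, 0 < lam j)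
    (hr : 0 < r) {Ω : Set Plane} (hΩ : IsOpen Ω) {q : Fin N → Plane} {i : Fin N}
    (hi : q i ∈ closure Ω) (a : ℝ) :
    ¬ ∀ᵐ x ∂(volume.restrict Ω), ∑ j, coverageRate (P j) (lam j) r x (q j) = a := by
  intro ha
  rw [ae_restrict_iff' hΩ.measurableSet] at ha
  have hne : (Metric.ball (q i) r ∩ Ω).Nonempty :=
    mem_closure_iff_nhds.1 hi _ (Metric.ball_mem_nhds _ hr)
  have hgen : ∀ᵐ x : Plane, ∀ j, x ≠ q j ∧ dist x (q j) ≠ r := by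
    rw [ae_all_iff]
    intro j
    have h1 : ∀ᵐ x : Plane, x ∉ Metric.sphere (q j) r :=
      measure_eq_zero_iff_ae_notMem.1 (Measure.addHaar_sphere volume (q j) r)
    filter_upwards [h1, Measure.ae_ne volume (q j)] with x hx hx'
    exact ⟨hx', hx⟩
  obtain ⟨x₀, hx₀, hx₀i, hx₀Ω⟩ :=
    (Measure.dense_of_ae hgen).exists_mem_open (Metric.isOpen_ball.inter hΩ) hne
  -- The agents that reach `x₀`. As `x₀` lies on none of the circles, the same agents reach all
  -- nearby points, so the rate is `g` there.
  let J : Finset (Fin N) := Finset.univ.filter fun j => dist x₀ (q j) < r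
  let g : Plane → ℝ := fun x => ∑ j ∈ J, P j * Real.exp (-lam j * dist x (q j))
  have hiJ : i ∈ J := by simpa [J] using hx₀i
  have hgc : Continuous g := by
    refine continuous_finsetSum _ fun j _ => ?_
    fun_prop
  have hpos : 0 < g x₀ :=
    Finset.sum_pos (fun j _ => mul_pos (hP j) (Real.exp_pos _)) ⟨i, hiJ⟩
  have hloc : ∀ᶠ x in 𝓝 x₀, x ∈ Ω ∧ ∑ j, coverageRate (P j) (lam j) r x (q j) = g x := by
    have hj : ∀ᶠ x in 𝓝 x₀, ∀ j, (dist x (q j) ≤ r ↔ j ∈ J) := by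
      rw [eventually_all]
      intro j
      have hd : Continuous fun x : Plane => dist x (q j) := continuous_id.dist continuous_const
      rcases (hx₀ j).2.lt_or_gt with h | h
      · filter_upwards [hd.continuousAt.eventually_lt_const h] with x hx
        simp [J, h, hx.le]
      · filter_upwards [hd.continuousAt.eventually_const_lt h] with x hx
        simp [J, h.not_gt, hx]
    filter_upwards [hΩ.mem_nhds hx₀Ω, hj] with x hx hxj
    refine ⟨hx, ?_⟩
    simp only [g, coverageRate, hxj]
    rw [Finset.sum_ite_mem, Finset.univ_inter]
  obtain ⟨U, hU, hUo, hxU⟩ := eventually_nhds_iff.1 hloc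
  have hgU : EqOn g (fun _ => a) U := by
    refine Measure.eqOn_open_of_ae_eq (μ := volume) ?_ hUo hgc.continuousOn continuousOn_const
    rw [EventuallyEq, ae_restrict_iff' hUo.measurableSet]
    filter_upwards [ha] with x hx hxU
    rw [← (hU x hxU).2, hx (hU x hxU).1]
  -- The distance to a site is analytic except at the site. The plane minus finitely many points is
  -- connected, so the identity theorem spreads `g = a` over it.
  have hga : AnalyticOnNhd ℝ g (range q)ᶜ := by
    intro x hx
    refine ContDiffAt.analyticAt ?_
    refine ContDiffAt.sum fun j _ => ?_
    have hxj : x ≠ q j := fun h => hx ⟨j, h.symm⟩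
    exact contDiffAt_const.mul ((contDiffAt_const.mul
      (contDiffAt_id.dist ℝ contDiffAt_const hxj)).exp)
  have hx₀q : x₀ ∈ (range q)ᶜ := by
    rintro ⟨j, hj⟩
    exact (hx₀ j).1 hj.symm
  have hfin : (range q).Finite := finite_range q
  have hEq : EqOn g (fun _ => a) (range q)ᶜ :=
    hga.eqOn_of_preconnected_of_eventuallyEq analyticOnNhd_const
      (hfin.countable.isConnected_compl_of_one_lt_rank (by
        rw [← Module.finrank_eq_rank, finrank_euclideanSpace_fin]; norm_num)).isPreconnected hx₀q
      (Filter.mem_of_superset (hUo.mem_nhds hxU) hgU)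
  have hlim : Tendsto g (cocompact Plane) (𝓝 0) := by
    rw [← Finset.sum_const_zero (s := J)]
    refine tendsto_finsetSum _ fun j _ => ?_
    have h1 : Tendsto (fun x : Plane => lam j * dist x (q j)) (cocompact Plane) atTop :=
      (tendsto_dist_right_cocompact_atTop (q j)).const_mul_atTop (hlam j)
    simpa using (Real.tendsto_exp_neg_atTop_nhds_zero.comp h1).const_mul (P j)
  have hlim' : Tendsto g (cocompact Plane) (𝓝 a) := by
    refine tendsto_const_nhds.congr' ?_
    filter_upwards [hfin.isCompact.compl_mem_cocompact] with x hx using (hEq hx).symm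
  have ha0 : a = 0 := tendsto_nhds_unique hlim' hlim
  have := hgU hxU
  simp only [ha0] at this
  exact hpos.ne' this

/-! ### Evolution and vanishing of the workload. -/

variable {s : Fin N → ℝ → Plane} {m₀ : Plane → ℝ}

theorem workload_nonneg (x : Plane) (t : ℝ) : 0 ≤ workload P lam r s m₀ x t := le_max_left _ _

theorem workload_antitone (hP : ∀ j, 0 < P j) (hlam : ∀ j, 0 < lam j)
    (hs : ∀ j, Continuous (s j)) (x : Plane) : Antitone (workload P lam r s m₀ x) := by
  intro a b hab
  exact max_le_max le_rfl (sub_le_sub_left (Finset.sum_le_sum fun j _ =>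
    coverage_mono (hP j).le (hlam j).le (hs j) x hab) _)

/-- If the workload is spatially constant from the time `t` on, it vanishes at the time `t`. -/
theorem workload_ae_eq_zero_of_const (hP : ∀ j, 0 < P j) (hlam : ∀ j, 0 < lam j) (hr : 0 < r)
    (hs : ∀ j, Continuous (s j)) {Ω : Set Plane} (hΩ : IsOpen Ω) {i : Fin N} {t : ℝ}
    (hi : s i t ∈ closure Ω) (h : ∀ t', t ≤ t' →
      ∃ a, ∀ᵐ x ∂(volume.restrict Ω), workload P lam r s m₀ x t' = a) :
    ∀ᵐ x ∂(volume.restrict Ω), workload P lam r s m₀ x t = 0 := by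
  obtain ⟨w, hw⟩ := h t le_rfl
  by_cases hw0 : w = 0
  · simpa [hw0] using hw
  exfalso
  -- A sequence of time increments keeps the union of the exceptional null sets null.
  let δ : ℕ → ℝ := fun n => 1 / ((n : ℝ) + 1)
  have hδ : ∀ n, 0 < δ n := fun n => by positivity
  choose! c hc using h
  have hall : ∀ᵐ x ∂(volume.restrict Ω), ∀ n, workload P lam r s m₀ x (t + δ n) = c (t + δ n) :=
    ae_all_iff.2 fun n => hc _ (by linarith [hδ n])
  have hgen : ∀ᵐ x ∂(volume.restrict Ω), ∀ j, dist x (s j t) ≠ r := by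
    rw [ae_all_iff]
    exact fun j => ae_restrict_of_ae
      (measure_eq_zero_iff_ae_notMem.1 (Measure.addHaar_sphere volume (s j t) r))
  -- The difference quotients do not depend on `x`, so neither does their limit, minus the total
  -- coverage rate.
  have hlim : ∀ᵐ x ∂(volume.restrict Ω), Tendsto (fun n => (δ n)⁻¹ * (c (t + δ n) - w)) atTop
      (𝓝 (-∑ j, coverageRate (P j) (lam j) r x (s j t))) := by
    filter_upwards [hw, hall, hgen] with x hx hxn hxr
    let v : ℝ → ℝ := fun τ => m₀ x - ∑ j, coverage (P j) (lam j) r (s j) x τ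
    have hd : HasDerivAt v (-∑ j, coverageRate (P j) (lam j) r x (s j t)) t :=
      (HasDerivAt.fun_sum fun j _ =>
        hasDerivAt_coverage (hP j).le (hlam j).le (hs j) (hxr j)).const_sub _
    have hxw : max 0 (v t) = w := hx
    have hvt : 0 < v t := by
      by_contra hv
      exact hw0 (hxw.symm.trans (max_eq_left (not_lt.1 hv)))
    have hd' : HasDerivAt (workload P lam r s m₀ x)
        (-∑ j, coverageRate (P j) (lam j) r x (s j t)) t := by
      refine hd.congr_of_eventuallyEq ?_
      filter_upwards [hd.continuousAt.eventually_const_lt hvt] with τ hτ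
      exact max_eq_right hτ.le
    have hδ' : Tendsto δ atTop (𝓝[≠] 0) :=
      tendsto_nhdsWithin_iff.2 ⟨tendsto_one_div_add_atTop_nhds_zero_nat,
        Eventually.of_forall fun n => (hδ n).ne'⟩
    have h1 := (hasDerivAt_iff_tendsto_slope_zero.1 hd').comp hδ'
    refine h1.congr fun n => ?_
    simp only [Function.comp_apply, smul_eq_mul, hxn n, hx]
  have hΩne : Ω.Nonempty := closure_nonempty_iff.1 ⟨_, hi⟩
  have : (ae (volume.restrict Ω)).NeBot :=
    ae_restrict_neBot.2 (hΩ.measure_pos volume hΩne).ne'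
  obtain ⟨x₁, hx₁⟩ := hlim.exists
  refine not_ae_sum_coverageRate_eq_const hP hlam hr hΩ (q := fun j => s j t) hi
    (∑ j, coverageRate (P j) (lam j) r x₁ (s j t)) ?_
  filter_upwards [hlim] with x hx
  exact neg_injective (tendsto_nhds_unique hx hx₁)

/-- For a lower semicontinuous initial workload, the workload vanishes at every point as soon as
it vanishes almost everywhere. -/
theorem workload_eq_zero_of_ae (hP : ∀ j, 0 < P j) (hlam : ∀ j, 0 < lam j)
    (hs : ∀ j, Continuous (s j)) {C : Set Plane} (hC : C ⊆ closure (interior C))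
    (hm₀ : LowerSemicontinuousOn m₀ C) {t : ℝ} (ht : 0 ≤ t)
    (h : ∀ᵐ x ∂(volume.restrict (interior C)), workload P lam r s m₀ x t = 0) {x : Plane}
    (hx : x ∈ C) : workload P lam r s m₀ x t = 0 := by
  refine max_eq_left (not_lt.1 fun hlt => ?_)
  -- The level `c` separates total coverage from `m₀` at `x`. By semicontinuity it still does so at
  -- nearby points of `C`, some of them in the interior and outside the null set.
  obtain ⟨c, hc, hc'⟩ := exists_between (sub_pos.1 hlt)
  have hcov : UpperSemicontinuous fun y => ∑ j, coverage (P j) (lam j) r (s j) y t :=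
    upperSemicontinuous_sum fun j _ =>
      upperSemicontinuous_coverage (hP j).le (hlam j).le (hs j) ht
  obtain ⟨V, hV, hVo, hxV⟩ := eventually_nhds_iff.1
    ((eventually_nhdsWithin_iff.1 (hm₀ x hx c hc')).and (hcov x c hc))
  rw [ae_restrict_iff' isOpen_interior.measurableSet] at h
  obtain ⟨y, hy, hyV, hyC⟩ := (Measure.dense_of_ae h).exists_mem_open
    (hVo.inter isOpen_interior) (mem_closure_iff_nhds.1 (hC hx) V (hVo.mem_nhds hxV))
  have h1 : m₀ y - ∑ j, coverage (P j) (lam j) r (s j) y t ≤ 0 := max_eq_left_iff.1 (hy hyC)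
  have h2 := (hV y hyV).1 (interior_subset hyC)
  have h3 := (hV y hyV).2
  linarith

theorem workload_congr {s' : Fin N → ℝ → Plane} (h : ∀ j τ, 0 ≤ τ → s j τ = s' j τ) {t : ℝ}
    (ht : 0 ≤ t) (x : Plane) : workload P lam r s m₀ x t = workload P lam r s' m₀ x t := by
  unfold workload
  simp only [coverage_congr (h _) ht]

end HeatCoverage

/-! ### The equivalences for the temperature field. -/

theorem proposition4p1 {N : ℕ} (D : Set HeatCoverage.Plane)
    (P lam : Fin N → ℝ) (r : ℝ) (hP : ∀ j, 0 < P j) (hlam : ∀ j, 0 < lam j) (hr : 0 < r)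
    -- trajectories of the agents, and the cell `C` of agent `i` for the initial positions
    (s : Fin N → ℝ → HeatCoverage.Plane) (hs : ∀ j, ContinuousOn (s j) (Set.Ici 0))
    (i : Fin N) (C : Set HeatCoverage.Plane)
    (hC : C = HeatCoverage.voronoiCell D (fun j => s j 0) i)
    (hCconn : IsConnected (interior C)) (hCreg : C ⊆ closure (interior C))
    (hsC : ∀ τ, 0 ≤ τ → s i τ ∈ C)
    -- the initial workload
    (m₀ : HeatCoverage.Plane → ℝ) (hm₀meas : Measurable m₀) (hm₀ : ∀ x ∈ D, 0 ≤ m₀ x)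
    (hm₀bdd : BddAbove (m₀ '' C)) (hm₀pos : 0 < HeatCoverage.maxWorkload m₀ C)
    -- the temperature field `T` on the cell, with weak gradient `G`
    (α β : ℝ) (hα : 0 < α) (hβ : 0 < β)
    (T : ℝ → HeatCoverage.Plane → ℝ) (G : ℝ → HeatCoverage.Plane → HeatCoverage.Plane)
    (hT : ∀ t, 0 ≤ t → HeatCoverage.IsNeumannSolution α β (interior C)
      (fun x => HeatCoverage.heatSource P lam r s m₀ C x t) (T t) (G t))
    (t : ℝ) (ht : 0 ≤ t) :
    -- almost everywhere, for an arbitrary bounded initial workload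
    ((∀ᵐ x ∂(MeasureTheory.volume.restrict (interior C)),
        HeatCoverage.heatSource P lam r s m₀ C x t = 0) ↔
      ∀ Δt : ℝ, 0 ≤ Δt →
        ∀ᵐ x ∂(MeasureTheory.volume.restrict (interior C)), G (t + Δt) x = 0) ∧
    -- at every point of the cell, for the continuous version of the temperature field
    (LowerSemicontinuousOn m₀ C → (∀ τ, 0 ≤ τ → ContinuousOn (T τ) C) →
      ((∀ x ∈ C, HeatCoverage.heatSource P lam r s m₀ C x t = 0) ↔
        ∀ Δt : ℝ, 0 ≤ Δt → ∀ x ∈ C, HasGradientWithinAt (T (t + Δt)) 0 C x)) := by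
  set Ω := interior C with hΩdef
  have hΩ : IsOpen Ω := isOpen_interior
  -- Freezing the agents at negative times makes the trajectories continuous on all of `ℝ`, so that
  -- the two-sided time derivative is available at `t = 0` too.
  let σ : Fin N → ℝ → HeatCoverage.Plane := fun j τ => s j (max τ 0)
  have hσ : ∀ j, Continuous (σ j) := fun j =>
    (hs j).comp_continuous (continuous_id.max continuous_const) fun τ =>
      Set.mem_Ici.2 (le_max_right _ _)
  have hsσ : ∀ j τ, 0 ≤ τ → s j τ = σ j τ := fun j τ hτ => by simp only [σ, max_eq_left hτ]
  have hsource : ∀ t, 0 ≤ t → ∀ x, ∀ a, HeatCoverage.heatSource P lam r s m₀ C x t = a ↔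
      HeatCoverage.workload P lam r σ m₀ x t = a * HeatCoverage.maxWorkload m₀ C := by
    intro t ht x a
    rw [HeatCoverage.heatSource, HeatCoverage.workload_congr hsσ ht, div_eq_iff hm₀pos.ne']
  have hzero : ∀ t, 0 ≤ t → ∀ x, HeatCoverage.heatSource P lam r s m₀ C x t = 0 ↔
      HeatCoverage.workload P lam r σ m₀ x t = 0 := by
    intro t ht x
    rw [hsource t ht, zero_mul]
  have hpersist : ∀ x, HeatCoverage.heatSource P lam r s m₀ C x t = 0 → ∀ Δt, 0 ≤ Δt →
      HeatCoverage.heatSource P lam r s m₀ C x (t + Δt) = 0 := by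
    intro x hx Δt hΔ
    rw [hzero _ ht] at hx
    rw [hzero _ (by linarith)]
    exact le_antisymm ((HeatCoverage.workload_antitone hP hlam hσ x (by linarith)).trans hx.le)
      (HeatCoverage.workload_nonneg _ _)
  have hpart1 : (∀ Δt : ℝ, 0 ≤ Δt →
      ∀ᵐ x ∂(MeasureTheory.volume.restrict Ω), G (t + Δt) x = 0) →
      ∀ᵐ x ∂(MeasureTheory.volume.restrict Ω), HeatCoverage.workload P lam r σ m₀ x t = 0 := by
    intro h
    refine HeatCoverage.workload_ae_eq_zero_of_const hP hlam hr hσ hΩ (i := i)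
      (hCreg (hsσ i t ht ▸ hsC t ht)) fun t' ht' => ?_
    have hG : ∀ᵐ x ∂(MeasureTheory.volume.restrict Ω), G t' x = 0 := by
      simpa using h (t' - t) (by linarith)
    obtain ⟨a, ha⟩ := (hT t' (ht.trans ht')).exists_source_ae_eq_const hΩ hCconn.isPreconnected hG
    exact ⟨_, ha.mono fun x hx => (hsource t' (ht.trans ht') x a).1 hx⟩
  refine ⟨⟨fun h Δt hΔ => ?_, fun h => ?_⟩, fun hlsc hTc => ⟨fun h Δt hΔ x hx => ?_, fun h => ?_⟩⟩
  · exact ((hT _ (by linarith)).ae_eq_zero hα hβ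
      (h.mono fun x hx => hpersist x hx Δt hΔ)).2
  · exact (hpart1 h).mono fun x hx => (hzero t ht x).2 hx
  -- Continuity upgrades `T = 0` almost everywhere to everywhere on the interior, and then to `C`,
  -- which lies in its closure.
  · have h0 : Set.EqOn (T (t + Δt)) (fun _ => 0) C := by
      have hc := hTc (t + Δt) (by linarith)
      exact (MeasureTheory.Measure.eqOn_open_of_ae_eq (μ := MeasureTheory.volume)
        ((hT _ (by linarith)).ae_eq_zero hα hβ (MeasureTheory.ae_restrict_of_forall_mem
          hΩ.measurableSet fun y hy => hpersist y (h y (interior_subset hy)) Δt hΔ)).1 hΩ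
        (hc.mono interior_subset) continuousOn_const).of_subset_closure hc continuousOn_const
        interior_subset hCreg
    exact (hasGradientWithinAt_const x C (0 : ℝ)).congr (fun y hy => h0 hy) (h0 hx)
  · refine fun x hx => (hzero t ht x).2 (HeatCoverage.workload_eq_zero_of_ae hP hlam hσ hCreg
      hlsc ht (hpart1 fun Δt hΔ => ?_) hx)
    -- In the interior the relative gradient is the ordinary one, so `T` is constant there and its
    -- weak gradient `G` vanishes almost everywhere.
    have hd : ∀ x ∈ Ω, HasFDerivAt (T (t + Δt)) (0 : HeatCoverage.Plane →L[ℝ] ℝ) x := by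
      intro x hx
      have := (h Δt hΔ x (interior_subset hx)).hasFDerivWithinAt.hasFDerivAt
        (mem_interior_iff_mem_nhds.1 hx)
      simpa using this
    obtain ⟨a, ha⟩ := hΩ.exists_is_const_of_fderiv_eq_zero hCconn.isPreconnected
      (fun x hx => (hd x hx).differentiableAt.differentiableWithinAt)
      (fun x hx => (hd x hx).fderiv)
    exact (hT _ (by linarith)).2.1.gradient_ae_eq_zero_of_const hΩ ha
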